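/- Let $(X,\mathcal B,\mu)$ be a standard probability space and let $T$ be an automorphism of it, i.e. an invertible bimeasurable transformation of $X$ preserving $\mu$. Denote by the same letter the Koopman operator $Tf=f\circ T$ on the complex Hilbert space $L_2(X,\mu)$, and let $\Theta$ be the orthogonal projection of $L_2(X,\mu)$ onto the space of constants. Then the following five properties are equivalent. 1. $T$ is weakly mixing: there is a sequence of natural numbers $n_i\to\infty$ such that $T^{n_i}\to\Theta$ in the weak operator topology, i.e. $\langle T^{n_i}f,g\rangle\to\langle\Theta f,g\rangle$ for all $f,g\in L_2(X,\mu)$. 2. The spectrum of $T$ on the orthogonal complement of the constants is continuous, i.e. $T$ has no eigenfunction there: if $f\in L_2(X,\mu)$ is orthogonal to the constants and $Tf=zf$ for some $z\in\mathbb C$, then $f=0$. 3. The product $T\times T$ is ergodic with respect to $\mu\times\mu$. 4. $T$ is almost mixing: for all $A,B\in\mathcal B$, $$\frac1N\sum_{i=1}^N\bigl|\mu(T^iA\cap B)-\mu(A)\mu(B)\bigr|\to0,\qquad N\to\infty.$$ 5. For every ergodic automorphism $S$ of a standard probability space $(Y,\nu)$, the product $S\times T$ is ergodic with respect to $\nu\times\mu$.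 -/

import Mathlib

open MeasureTheory Filter Topology

noncomputable section

universe u

variable {X : Type u} [MeasurableSpace X] {μ : Measure X}

/-- The Koopman operator `f ↦ f ∘ T` on the complex Hilbert space `L²(X, μ)`. -/
def koopman (T : X ≃ᵐ X) (hT : MeasurePreserving T μ μ) : Lp ℂ 2 μ →L[ℂ] Lp ℂ 2 μ :=
  (Lp.compMeasurePreservingₗᵢ ℂ T hT).toContinuousLinearMap

/-- The one-dimensional subspace of (classes of) constant functions in `L²(X, μ)`. -/
def constants (μ : Measure X) [IsProbabilityMeasure μ] : Submodule ℂ (Lp ℂ 2 μ) :=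
  Submodule.span ℂ {Lp.const 2 μ (1 : ℂ)}

instance (μ : Measure X) [IsProbabilityMeasure μ] : FiniteDimensional ℂ (constants μ) := by
  unfold constants; infer_instance

/-- The orthogonal projection of `L²(X, μ)` onto the constants. -/
def Theta (μ : Measure X) [IsProbabilityMeasure μ] : Lp ℂ 2 μ →L[ℂ] Lp ℂ 2 μ :=
  (constants μ).starProjection

/-- Weak mixing: the powers of the Koopman operator converge to `Theta` in the weak operator
topology along some sequence `n i → ∞`. -/
def IsWeaklyMixing [IsProbabilityMeasure μ] (T : X ≃ᵐ X) (hT : MeasurePreserving T μ μ) : Prop :=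
  ∃ n : ℕ → ℕ, Tendsto n atTop atTop ∧
    ∀ f g : Lp ℂ 2 μ,
      Tendsto (fun i => inner ℂ g ((koopman T hT ^ n i) f)) atTop (𝓝 (inner ℂ g (Theta μ f)))

/-- Continuous spectrum on the orthocomplement of the constants: the Koopman operator has no
eigenfunction there. -/
def HasContinuousSpectrum [IsProbabilityMeasure μ] (T : X ≃ᵐ X)
    (hT : MeasurePreserving T μ μ) : Prop :=
  ∀ (z : ℂ) (f : Lp ℂ 2 μ), f ∈ (constants μ)ᗮ → koopman T hT f = z • f → f = 0

/-- Almost mixing: for all measurable `A`, `B`, the Cesàro averages of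
`|μ(Tⁱ A ∩ B) - μ(A) μ(B)|` tend to `0`. -/
def IsAlmostMixing (μ : Measure X) (T : X ≃ᵐ X) : Prop :=
  ∀ A B : Set X, MeasurableSet A → MeasurableSet B →
    Tendsto (fun N : ℕ => (1 / (N : ℝ)) *
        ∑ i ∈ Finset.Icc 1 N, |μ.real ((T^[i]) '' A ∩ B) - μ.real A * μ.real B|)
      atTop (𝓝 0)

/-- `S × T` is ergodic for every ergodic automorphism `S` of a standard probability space. -/
def HasErgodicProducts (μ : Measure X) (T : X ≃ᵐ X) : Prop :=
  ∀ (Y : Type u) [MeasurableSpace Y] [StandardBorelSpace Y] (ν : Measure Y)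
    [IsProbabilityMeasure ν] (S : Y ≃ᵐ Y),
    Ergodic S ν → Ergodic (Prod.map S T) (ν.prod μ)

end

/-!
The heart of the matter is that a continuous spectrum forces `⟪g, Uⁱ f⟫` to decay in mean square,
where `U` is an isometry of a Hilbert space `H` and `f` is orthogonal to all eigenvectors of `U`.
The mean ergodic theorem for `U ⊗ Ū` on the tensor product of `H` with its conjugate, whose elements
represent Hilbert–Schmidt operators, shows that the averages of the rank-one operators
`⟪Uⁱ f, ·⟫ Uⁱ f` converge in norm. The limit `A` is compact, self-adjoint and commutes with `U`, so
if it were nonzero, one of its finite-dimensional eigenspaces would contain an eigenvector `v` of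
`U` with `⟪v, A v⟫ ≠ 0`; but `⟪v, A v⟫` is the average of `|⟪v, Uⁱ f⟫|² = 0`. Hence `A = 0`, and
`⟪g, A g⟫` is the average of `|⟪g, Uⁱ f⟫|²`.

For the Koopman operator this decay yields almost mixing, and a single sequence `n i` serving a
countable dense set of pairs yields weak mixing. If `T` is almost mixing and `S` is ergodic, then
`S × T` mixes rectangles in the mean, hence is ergodic; the ergodicity of `T × T` excludes an
eigenfunction `f`, since `f(x) * conj (f(y))` would be invariant.
-/

section Cesaro

/-- The `N`-th Cesàro average `(c 0 + ⋯ + c (N - 1)) / N` of a sequence, with real weights even in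
complex spaces; its value at `N = 0` is `0`. -/
noncomputable def cesaro {E : Type*} [AddCommMonoid E] [Module ℝ E] (c : ℕ → E) (N : ℕ) : E :=
  (N : ℝ)⁻¹ • ∑ i ∈ Finset.range N, c i

lemma cesaro_sum {ι E : Type*} [AddCommMonoid E] [Module ℝ E] (s : Finset ι) (c : ι → ℕ → E)
    (N : ℕ) : cesaro (fun i => ∑ k ∈ s, c k i) N = ∑ k ∈ s, cesaro (c k) N := by
  simp only [cesaro, Finset.smul_sum]
  exact Finset.sum_comm

lemma map_cesaro {E F 𝓕 : Type*} [AddCommGroup E] [Module ℝ E] [AddCommGroup F] [Module ℝ F]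
    [FunLike 𝓕 E F] [AddMonoidHomClass 𝓕 E F] (φ : 𝓕) (c : ℕ → E) (N : ℕ) :
    φ (cesaro c N) = cesaro (fun i => φ (c i)) N := by
  simp only [cesaro, map_inv_natCast_smul φ ℝ ℝ, map_sum]

lemma birkhoffAverage_eq_cesaro {E : Type*} (𝕜 : Type*) [RCLike 𝕜] [AddCommGroup E] [Module ℝ E]
    [Module 𝕜 E] (f : E → E) (x : E) (N : ℕ) :
    birkhoffAverage 𝕜 f id N x = cesaro (fun i => f^[i] x) N := by
  rw [birkhoffAverage_congr_ring 𝕜 ℝ]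
  rfl

variable {E : Type*} [NormedAddCommGroup E] [NormedSpace ℝ E]

lemma tendsto_map_cesaro {F : Type*} [AddCommGroup F] [Module ℝ F] [TopologicalSpace F]
    {𝓕 : Type*} [FunLike 𝓕 E F] [AddMonoidHomClass 𝓕 E F] [ContinuousMapClass 𝓕 E F] (φ : 𝓕)
    {c : ℕ → E} {l : E} (h : Tendsto (cesaro c) atTop (𝓝 l)) :
    Tendsto (cesaro fun i => φ (c i)) atTop (𝓝 (φ l)) :=
  (((map_continuous φ).tendsto l).comp h).congr fun N => map_cesaro φ c N

lemma tendsto_cesaro_const (l : E) : Tendsto (cesaro fun _ => l) atTop (𝓝 l) :=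
  tendsto_const_nhds.cesaro_smul

lemma tendsto_cesaro_ofReal_iff {c : ℕ → ℝ} {l : ℝ} :
    Tendsto (cesaro fun i => (c i : ℂ)) atTop (𝓝 (l : ℂ)) ↔ Tendsto (cesaro c) atTop (𝓝 l) :=
  ⟨fun h => by simpa using tendsto_map_cesaro Complex.reCLM h,
    fun h => tendsto_map_cesaro Complex.ofRealCLM h⟩

lemma tendsto_cesaro_succ_iff {c : ℕ → E} {M : ℝ} (hM : ∀ i, ‖c i‖ ≤ M) {l : E} :
    Tendsto (cesaro fun i => c (i + 1)) atTop (𝓝 l) ↔ Tendsto (cesaro c) atTop (𝓝 l) := by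
  refine tendsto_iff_of_dist (squeeze_zero (g := fun N : ℕ => (N : ℝ)⁻¹ * (M + M))
    (fun N => dist_nonneg) (fun N => ?_) ?_)
  · rw [dist_eq_norm, cesaro, cesaro, ← smul_sub, ← Finset.sum_sub_distrib, Finset.sum_range_sub,
      norm_smul, norm_inv, Real.norm_natCast]
    gcongr
    exact norm_sub_le_of_le (hM N) (hM 0)
  · simpa using (tendsto_inv_atTop_nhds_zero_nat (𝕜 := ℝ)).mul_const (M + M)

lemma one_div_mul_sum_Icc_eq_cesaro (c : ℕ → ℝ) (N : ℕ) :
    1 / (N : ℝ) * ∑ i ∈ Finset.Icc 1 N, c i = cesaro (fun i => c (i + 1)) N := by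
  rw [cesaro, smul_eq_mul, one_div, Finset.range_eq_Ico, Finset.sum_Ico_add' c 0 N 1]
  rfl

lemma cesaro_nonneg {c : ℕ → ℝ} (hc : ∀ i, 0 ≤ c i) (N : ℕ) : 0 ≤ cesaro c N :=
  smul_nonneg (by positivity) (Finset.sum_nonneg fun i _ => hc i)

lemma cesaro_mono {c d : ℕ → ℝ} (h : ∀ i, c i ≤ d i) (N : ℕ) : cesaro c N ≤ cesaro d N :=
  smul_le_smul_of_nonneg_left (Finset.sum_le_sum fun i _ => h i) (by positivity)

lemma norm_cesaro_le (c : ℕ → E) (N : ℕ) : ‖cesaro c N‖ ≤ cesaro (fun i => ‖c i‖) N := by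
  rw [cesaro, norm_smul, norm_inv, Real.norm_natCast]
  exact mul_le_mul_of_nonneg_left (norm_sum_le _ _) (by positivity)

lemma sq_cesaro_le (c : ℕ → ℝ) (N : ℕ) : cesaro c N ^ 2 ≤ cesaro (fun i => c i ^ 2) N := by
  have cauchy_schwarz := sq_sum_le_card_mul_sum_sq (s := Finset.range N) (f := c)
  rw [Finset.card_range] at cauchy_schwarz
  calc cesaro c N ^ 2 = (N : ℝ)⁻¹ ^ 2 * (∑ i ∈ Finset.range N, c i) ^ 2 := mul_pow _ _ _
    _ ≤ (N : ℝ)⁻¹ ^ 2 * (N * ∑ i ∈ Finset.range N, c i ^ 2) := by gcongr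
    _ = cesaro (fun i => c i ^ 2) N := by
      rcases eq_or_ne N 0 with rfl | hN
      · simp [cesaro]
      · rw [cesaro, smul_eq_mul]; field_simp

lemma tendsto_cesaro_abs_of_sq {c : ℕ → ℝ} (h : Tendsto (cesaro fun i => c i ^ 2) atTop (𝓝 0)) :
    Tendsto (cesaro fun i => |c i|) atTop (𝓝 0) := by
  refine squeeze_zero (cesaro_nonneg fun i => abs_nonneg _)
    (fun N => Real.le_sqrt_of_sq_le ?_) (by simpa using h.sqrt)
  simpa only [sq_abs] using sq_cesaro_le (fun i => |c i|) N

lemma tendsto_cesaro_mul {a b : ℕ → ℝ} {α β M : ℝ} (haM : ∀ i, |a i| ≤ M)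
    (ha : Tendsto (cesaro a) atTop (𝓝 α)) (hb : Tendsto (cesaro fun i => |b i - β|) atTop (𝓝 0)) :
    Tendsto (cesaro fun i => a i * b i) atTop (𝓝 (α * β)) := by
  have h_error : Tendsto (cesaro fun i => a i * (b i - β)) atTop (𝓝 0) := by
    refine squeeze_zero_norm (fun N => (norm_cesaro_le _ N).trans (cesaro_mono (fun i => ?_) N))
      (by simpa using tendsto_map_cesaro (ContinuousLinearMap.mul ℝ ℝ M) hb)
    rw [norm_mul]
    exact mul_le_mul_of_nonneg_right (haM i) (abs_nonneg _)
  have h_main := tendsto_map_cesaro ((ContinuousLinearMap.mul ℝ ℝ).flip β) ha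
  have h_add := h_error.add h_main
  rw [zero_add] at h_add
  refine h_add.congr fun N => ?_
  simp only [cesaro, ← smul_add, ← Finset.sum_add_distrib, ContinuousLinearMap.flip_apply,
    ContinuousLinearMap.mul_apply', ← mul_add, sub_add_cancel]

lemma frequently_lt_of_tendsto_cesaro {c : ℕ → ℝ} {l ε : ℝ}
    (h : Tendsto (cesaro c) atTop (𝓝 l)) (hε : l < ε) : ∃ᶠ n in atTop, c n < ε := by
  intro h_ge
  simp only [not_lt] at h_ge
  have h_min : Tendsto (fun n => min (c n) ε) atTop (𝓝 ε) :=
    tendsto_const_nhds.congr' (h_ge.mono fun n hn => (min_eq_right hn).symm)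
  exact hε.not_ge (le_of_tendsto_of_tendsto' h_min.cesaro_smul h
    (cesaro_mono fun n => min_le_left _ _))

lemma exists_strictMono_tendsto_zero_of_tendsto_cesaro {ι : Type*} [Countable ι] {c : ι → ℕ → ℝ}
    (hc : ∀ k n, 0 ≤ c k n) (h : ∀ k, Tendsto (cesaro (c k)) atTop (𝓝 0)) :
    ∃ n : ℕ → ℕ, StrictMono n ∧ ∀ k, Tendsto (fun i => c k (n i)) atTop (𝓝 0) := by
  have h_cluster : MapClusterPt (0 : ι → ℝ) atTop fun n k => c k n := by
    have h_basis := nhds_pi (a := (0 : ι → ℝ)) ▸ hasBasis_pi fun k => Metric.nhds_basis_ball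
    refine h_basis.mapClusterPt_iff_frequently.2 ?_
    rintro ⟨I, ε⟩ ⟨hI, hε⟩
    have h_sum : Tendsto (cesaro fun n => ∑ k ∈ hI.toFinset, (ε k)⁻¹ * c k n) atTop (𝓝 0) := by
      have h_each : ∀ k ∈ hI.toFinset, Tendsto (cesaro fun n => (ε k)⁻¹ * c k n) atTop (𝓝 0) :=
        fun k _ => by
          simpa using tendsto_map_cesaro (ContinuousLinearMap.mul ℝ ℝ (ε k)⁻¹) (h k)
      have h_sums := tendsto_finsetSum _ h_each
      rw [Finset.sum_const_zero] at h_sums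
      exact h_sums.congr fun N => (cesaro_sum _ _ N).symm
    have h_nonneg : ∀ n, ∀ k ∈ hI.toFinset, 0 ≤ (ε k)⁻¹ * c k n := fun n k hk =>
      mul_nonneg (inv_nonneg.2 (hε k (hI.mem_toFinset.1 hk)).le) (hc k n)
    refine (frequently_lt_of_tendsto_cesaro h_sum one_pos).mono fun n hn k hk => ?_
    have h_lt := (Finset.single_le_sum (h_nonneg n) (hI.mem_toFinset.2 hk)).trans_lt hn
    rw [inv_mul_lt_one₀ (hε k hk)] at h_lt
    simpa [abs_of_nonneg (hc k n)] using h_lt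
  obtain ⟨n, hn, h_lim⟩ := h_cluster.tendsto_subseq
  exact ⟨n, hn, tendsto_pi_nhds.1 h_lim⟩

end Cesaro

section MeanErgodic

lemma norm_completion_le {𝕜 E : Type*} [NontriviallyNormedField 𝕜] [SeminormedAddCommGroup E]
    [NormedSpace 𝕜 E] (f : E →L[𝕜] E) : ‖f.completion‖ ≤ ‖f‖ := by
  refine f.completion.opNorm_le_bound (norm_nonneg f) fun x => ?_
  induction x using UniformSpace.Completion.induction_on with
  | hp => exact isClosed_le (by fun_prop) (by fun_prop)
  | ih x =>
    simpa only [f.completion_apply_coe, UniformSpace.Completion.norm_coe] using f.le_opNorm x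

variable {𝕜 E : Type*} [RCLike 𝕜] [NormedAddCommGroup E] [NormedSpace ℝ E]
  [InnerProductSpace 𝕜 E]

lemma exists_fixed_tendsto_cesaro_iterate {f : E →L[𝕜] E} [CompleteSpace E] (hf : ‖f‖ ≤ 1)
    (x : E) : ∃ y, f y = y ∧ Tendsto (cesaro fun i => f^[i] x) atTop (𝓝 y) := by
  have h_lim := f.tendsto_birkhoffAverage_orthogonalProjection hf x
  simp only [birkhoffAverage_eq_cesaro] at h_lim
  have h_fixed : ∀ y : f.eqLocus (1 : E →L[𝕜] E), f y = y := fun y => y.2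
  exact ⟨_, h_fixed _, h_lim⟩

lemma cauchySeq_cesaro_iterate {f : E →L[𝕜] E} (hf : ‖f‖ ≤ 1) (x : E) :
    CauchySeq (cesaro fun i => f^[i] x) := by
  obtain ⟨y, -, h_lim⟩ := exists_fixed_tendsto_cesaro_iterate
    ((norm_completion_le f).trans hf) (x : UniformSpace.Completion E)
  have h_orbit : ∀ i, f.completion^[i] (x : UniformSpace.Completion E) = ↑(f^[i] x) := fun i =>
    (Function.Semiconj.iterate_right (fun y => (f.completion_apply_coe y).symm) i x).symm
  have h_coe : cesaro (fun i => (↑(f^[i] x) : UniformSpace.Completion E)) =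
      fun N => ↑(cesaro (fun i => f^[i] x) N) :=
    funext fun N => (map_cesaro (UniformSpace.Completion.toComplₗᵢ (𝕜 := 𝕜)) _ N).symm
  simp only [h_orbit, h_coe] at h_lim
  exact (UniformSpace.Completion.isUniformInducing_coe E).cauchy_map_iff.1 h_lim.cauchySeq

end MeanErgodic

section HilbertSchmidt

open InnerProductSpace TensorProduct

lemma inner_map_map_of_antiunitary {H K : Type*} [NormedAddCommGroup H] [InnerProductSpace ℂ H]
    [NormedAddCommGroup K] [InnerProductSpace ℂ K] (J : H →ₗᵢ⋆[ℂ] K) (x y : H) :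
    inner ℂ (J x) (J y) = inner ℂ y x := by
  rw [← inner_conj_symm, inner_eq_sum_norm_sq_div_four, inner_eq_sum_norm_sq_div_four]
  have h_sub : ‖J y - Complex.I • J x‖ = ‖y + Complex.I • x‖ := by
    rw [← J.norm_map, map_add, map_smulₛₗ, Complex.conj_I, neg_smul, sub_eq_add_neg]
  have h_add : ‖J y + Complex.I • J x‖ = ‖y - Complex.I • x‖ := by
    rw [← J.norm_map, map_sub, map_smulₛₗ, Complex.conj_I, neg_smul, sub_neg_eq_add]
  simp only [RCLike.I_to_complex, h_sub, h_add, ← map_add, ← map_sub, J.norm_map]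
  simp only [map_div₀, map_add, map_sub, map_mul, map_pow, Complex.coe_algebraMap,
    Complex.conj_ofReal, Complex.conj_I, map_ofNat]
  ring

variable {H K : Type*} [NormedAddCommGroup H] [InnerProductSpace ℂ H]
  [NormedAddCommGroup K] [InnerProductSpace ℂ K] (J : H ≃ₗᵢ⋆[ℂ] K)

/-- The finite-rank operator on `H` represented by an element of `H ⊗ K`, where `J : H → K`
identifies `K` with the conjugate Hilbert space of `H`: `x ⊗ J y` represents `⟪y, ·⟫ x`. -/
noncomputable def finiteRankOp : H ⊗[ℂ] K →ₗ[ℂ] H →L[ℂ] H :=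
  TensorProduct.lift <|
    ((rankOne ℂ).toLinearMap₁₂.flip.comp J.symm.toLinearEquiv.toLinearMap).flip

lemma finiteRankOp_tmul (x y : H) : finiteRankOp J (x ⊗ₜ J y) = rankOne ℂ x y := by
  simp [finiteRankOp]

lemma inner_finiteRankOp_apply (t : H ⊗[ℂ] K) (g h : H) :
    inner ℂ g (finiteRankOp J t h) = inner ℂ (g ⊗ₜ[ℂ] J h) t := by
  induction t using TensorProduct.induction_on with
  | zero => simp
  | add s t hs ht => rw [map_add, _root_.add_apply, inner_add_right, inner_add_right, hs, ht]
  | tmul x φ =>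
    obtain ⟨y, rfl⟩ := J.surjective φ
    rw [finiteRankOp_tmul, inner_right_rankOne_apply, inner_tmul,
      ← inner_map_map_of_antiunitary J.toLinearIsometry h y]
    rfl

lemma norm_finiteRankOp_le (t : H ⊗[ℂ] K) : ‖finiteRankOp J t‖ ≤ ‖t‖ := by
  refine ContinuousLinearMap.opNorm_le_bound _ (norm_nonneg t) fun h => ?_
  generalize hg : finiteRankOp J t h = g
  have h_sq : ‖g‖ * ‖g‖ ≤ ‖g‖ * (‖t‖ * ‖h‖) :=
    calc ‖g‖ * ‖g‖ = ‖inner ℂ (g ⊗ₜ[ℂ] J h) t‖ := by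
          rw [← inner_finiteRankOp_apply, hg, ← inner_self_re_eq_norm, inner_self_eq_norm_mul_norm]
      _ ≤ ‖g ⊗ₜ[ℂ] J h‖ * ‖t‖ := norm_inner_le_norm (𝕜 := ℂ) (g ⊗ₜ[ℂ] J h) t
      _ = ‖g‖ * (‖t‖ * ‖h‖) := by rw [norm_tmul, J.norm_map, mul_assoc, mul_comm ‖h‖]
  rcases (norm_nonneg g).eq_or_lt with h_zero | h_pos
  · exact h_zero ▸ mul_nonneg (norm_nonneg t) (norm_nonneg h)
  · exact le_of_mul_le_mul_left h_sq h_pos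

lemma cauchySeq_cesaro_rankOne_iterate_of_antiunitary (J : H ≃ₗᵢ⋆[ℂ] K) (U : H →ₗᵢ[ℂ] H) (f : H) :
    CauchySeq (cesaro fun i => rankOne ℂ (U^[i] f) (U^[i] f)) := by
  let V : K →ₗᵢ[ℂ] K := (J.toLinearIsometry.comp U).comp J.symm.toLinearIsometry
  let W := (mapIsometry U V).toContinuousLinearMap
  let Φ := (finiteRankOp J).mkContinuous 1 fun t => by
    simpa only [one_mul] using norm_finiteRankOp_le J t
  have h_orbit : ∀ i, W^[i] (f ⊗ₜ J f) = (U^[i] f) ⊗ₜ J (U^[i] f) := fun i => by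
    induction i with
    | zero => rfl
    | succ i ih =>
      rw [Function.iterate_succ_apply', ih, Function.iterate_succ_apply']
      simp [W, V]
  have h_cauchy := Φ.uniformContinuous.comp_cauchySeq
    (cauchySeq_cesaro_iterate (mapIsometry U V).norm_toContinuousLinearMap_le (f ⊗ₜ J f))
  have h_image : Φ ∘ cesaro (fun i => W^[i] (f ⊗ₜ J f)) =
      cesaro fun i => rankOne ℂ (U^[i] f) (U^[i] f) := by
    funext N
    rw [Function.comp_apply, map_cesaro]
    simp only [h_orbit]
    exact congrFun (congrArg cesaro (funext fun i => finiteRankOp_tmul J _ _)) N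
  exact h_image ▸ h_cauchy

lemma cauchySeq_cesaro_rankOne_iterate [CompleteSpace H] (U : H →ₗᵢ[ℂ] H) (f : H) :
    CauchySeq (cesaro fun i => rankOne ℂ (U^[i] f) (U^[i] f)) := by
  let riesz : InnerProductSpace ℂ (StrongDual ℂ H) :=
    { inner := fun φ ψ => inner ℂ ((toDual ℂ H).symm ψ) ((toDual ℂ H).symm φ)
      norm_sq_eq_re_inner := fun φ => by
        rw [inner_self_eq_norm_sq, LinearIsometryEquiv.norm_map]
      conj_inner_symm := fun φ ψ => inner_conj_symm _ _
      add_left := fun φ ψ χ => by rw [map_add, inner_add_right]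
      smul_left := fun φ ψ z => by rw [map_smulₛₗ, inner_smul_right] }
  exact cauchySeq_cesaro_rankOne_iterate_of_antiunitary (toDual ℂ H) U f

end HilbertSchmidt

section Decay

open InnerProductSpace

variable {H : Type*} [NormedAddCommGroup H] [InnerProductSpace ℂ H]

lemma isCompactOperator_rankOne (x y : H) : IsCompactOperator (rankOne ℂ x y) :=
  (isCompactOperator_of_locallyCompactSpace_dom (innerSL ℂ y)).clm_comp (.toSpanSingleton ℂ x)

lemma norm_eq_one_of_map_eq_smul {U : H →ₗᵢ[ℂ] H} {z : ℂ} {v : H} (hv : v ≠ 0)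
    (hz : U v = z • v) : ‖z‖ = 1 := by
  have h_norm := U.norm_map v
  rw [hz, norm_smul] at h_norm
  exact (mul_eq_right₀ (norm_ne_zero_iff.2 hv)).1 h_norm

lemma inner_iterate_eq_zero {U : H →ₗᵢ[ℂ] H} {z : ℂ} {v f : H} (hz : U v = z • v)
    (hvf : inner ℂ v f = 0) (i : ℕ) : inner ℂ v (U^[i] f) = 0 := by
  rcases eq_or_ne v 0 with rfl | hv
  · exact inner_zero_left _
  have hz0 : z ≠ 0 := norm_ne_zero_iff.1 (norm_eq_one_of_map_eq_smul hv hz ▸ one_ne_zero)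
  induction i with
  | zero => exact hvf
  | succ i ih =>
    have h_smul : inner ℂ (z • v) (U^[i + 1] f) = 0 := by
      rw [← hz, Function.iterate_succ_apply', U.inner_map_map, ih]
    simpa [inner_smul_left, hz0] using h_smul

variable {A : H →L[ℂ] H}

lemma tendsto_cesaro_inner_mul_inner {u v : ℕ → H}
    (hA : Tendsto (cesaro fun i => rankOne ℂ (u i) (v i)) atTop (𝓝 A)) (g h : H) :
    Tendsto (cesaro fun i => inner ℂ g (u i) * inner ℂ (v i) h) atTop (𝓝 (inner ℂ g (A h))) := by
  simpa [mul_comm] using tendsto_map_cesaro ((innerSL ℂ g).comp (.apply ℂ H h)) hA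

lemma isSymmetric_of_tendsto_cesaro_rankOne {u : ℕ → H}
    (hA : Tendsto (cesaro fun i => rankOne ℂ (u i) (u i)) atTop (𝓝 A)) : A.IsSymmetric := by
  intro x y
  have h_conj := tendsto_map_cesaro Complex.conjCLE (tendsto_cesaro_inner_mul_inner hA y x)
  simp only [Complex.conjCLE_apply, map_mul, inner_conj_symm, mul_comm (inner ℂ (u _) y)] at h_conj
  exact tendsto_nhds_unique h_conj (tendsto_cesaro_inner_mul_inner hA x y)

variable [CompleteSpace H]

lemma exists_common_eigenvector_of_commute {A U : H →L[ℂ] H} (hA : IsCompactOperator A)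
    (hsymm : A.IsSymmetric) (hne : A ≠ 0) (hcomm : Commute A U) :
    ∃ (a z : ℂ) (v : H), a ≠ 0 ∧ v ≠ 0 ∧ A v = a • v ∧ U v = z • v := by
  have h_eigen := mt (ContinuousLinearMap.eq_zero_of_forall_hasEigenvalue_eq_zero hA hsymm).1 hne
  push Not at h_eigen
  obtain ⟨a, ha, ha0⟩ := h_eigen
  have := ContinuousLinearMap.finite_dimensional_eigenspace hA a ha0
  have h_maps : ∀ x ∈ Module.End.eigenspace A.toLinearMap a,
      U.toLinearMap x ∈ Module.End.eigenspace A.toLinearMap a := fun x hx => by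
    rw [Module.End.mem_eigenspace_iff] at hx ⊢
    exact (DFunLike.congr_fun hcomm.eq x).trans ((congrArg U hx).trans (map_smul U a x))
  have : Nontrivial (Module.End.eigenspace A.toLinearMap a) :=
    Submodule.nontrivial_iff_ne_bot.2 ha
  obtain ⟨z, hz⟩ := Module.End.exists_eigenvalue (U.toLinearMap.restrict h_maps)
  obtain ⟨v, hv, hv0⟩ := hz.exists_hasEigenvector
  rw [Module.End.mem_eigenspace_iff] at hv
  exact ⟨a, z, v, ha0, Subtype.coe_ne_coe.2 hv0, Module.End.mem_eigenspace_iff.1 v.2,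
    congrArg Subtype.val hv⟩

lemma isCompactOperator_of_tendsto_cesaro_rankOne {u v : ℕ → H}
    (hA : Tendsto (cesaro fun i => rankOne ℂ (u i) (v i)) atTop (𝓝 A)) : IsCompactOperator A := by
  refine isCompactOperator_of_tendsto hA (Eventually.of_forall fun N => ?_)
  exact (compactOperator (RingHom.id ℂ) H H).smul_of_tower_mem _
      (Submodule.sum_mem _ fun i _ => isCompactOperator_rankOne _ _)

lemma commute_of_tendsto_cesaro_rankOne_iterate {U : H →ₗᵢ[ℂ] H} {f : H}
    (hA : Tendsto (cesaro fun i => rankOne ℂ (U^[i] f) (U^[i] f)) atTop (𝓝 A)) :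
    Commute A U.toContinuousLinearMap := by
  let V := U.toContinuousLinearMap
  have h_isometry : V.adjoint * V = 1 :=
    (ContinuousLinearMap.norm_map_iff_adjoint_comp_self V).1 U.norm_map
  have h_conj : V * A * V.adjoint = A := by
    refine ContinuousLinearMap.ext fun x => ext_inner_left ℂ fun y => ?_
    have h_shift := (tendsto_cesaro_succ_iff (M := ‖y‖ * ‖f‖ * (‖f‖ * ‖x‖))
      (c := fun i => inner ℂ y (U^[i] f) * inner ℂ (U^[i] f) x) fun i => ?_).2
      (tendsto_cesaro_inner_mul_inner hA y x)
    · have h_lim := tendsto_cesaro_inner_mul_inner hA (V.adjoint y) (V.adjoint x)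
      simp only [ContinuousLinearMap.adjoint_inner_left,
        ContinuousLinearMap.adjoint_inner_right] at h_lim
      simp only [Function.iterate_succ_apply'] at h_shift
      exact tendsto_nhds_unique h_lim h_shift
    · have h_norm : ‖U^[i] f‖ = ‖f‖ := by rw [← LinearIsometry.coe_pow, LinearIsometry.norm_map]
      rw [norm_mul, ← h_norm]
      gcongr <;> exact norm_inner_le_norm _ _
  calc A * V = V * A * V.adjoint * V := by rw [h_conj]
    _ = V * A := by rw [mul_assoc, h_isometry, mul_one]

theorem tendsto_cesaro_norm_inner_iterate_sq {U : H →ₗᵢ[ℂ] H} {f : H}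
    (hf : ∀ (z : ℂ) (v : H), U v = z • v → inner ℂ v f = 0) (g : H) :
    Tendsto (cesaro fun i => ‖inner ℂ g (U^[i] f)‖ ^ 2) atTop (𝓝 0) := by
  obtain ⟨A, hA⟩ := cauchySeq_tendsto_of_complete (cauchySeq_cesaro_rankOne_iterate U f)
  have h_zero : A = 0 := by
    by_contra hne
    obtain ⟨a, z, v, ha0, hv0, hAv, hUv⟩ := exists_common_eigenvector_of_commute
      (isCompactOperator_of_tendsto_cesaro_rankOne hA) (isSymmetric_of_tendsto_cesaro_rankOne hA)
      hne (commute_of_tendsto_cesaro_rankOne_iterate hA)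
    have h_lim := tendsto_cesaro_inner_mul_inner hA v v
    simp only [inner_iterate_eq_zero hUv (hf z v hUv), zero_mul] at h_lim
    have h_inner : inner ℂ v (A v) = 0 := tendsto_nhds_unique h_lim (tendsto_cesaro_const 0)
    simp [hAv, ha0, hv0] at h_inner
  have h_lim := tendsto_cesaro_inner_mul_inner hA g g
  rw [h_zero, _root_.zero_apply, inner_zero_right, ← Complex.ofReal_zero] at h_lim
  refine tendsto_cesaro_ofReal_iff.1 (h_lim.congr fun N => congrFun (congrArg cesaro ?_) N)
  funext i
  rw [← inner_conj_symm _ g, RCLike.mul_conj]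
  norm_cast

end Decay

section Ergodic

open ProbabilityTheory

variable {Z : Type*} [MeasurableSpace Z] {ρ : Measure Z} {S : Z → Z}

lemma inner_indicator_iterate_compMeasurePreserving (𝕜 : Type*) [RCLike 𝕜] [IsFiniteMeasure ρ]
    (hS : MeasurePreserving S ρ ρ) {A C : Set Z} (hA : MeasurableSet A) (hC : MeasurableSet C)
    (i : ℕ) :
    inner 𝕜 (indicatorConstLp 2 hA (measure_ne_top ρ A) (1 : 𝕜))
      ((Lp.compMeasurePreservingₗᵢ 𝕜 S hS)^[i]
        (indicatorConstLp 2 hC (measure_ne_top ρ C) (1 : 𝕜))) =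
      (ρ.real (A ∩ S^[i] ⁻¹' C) : 𝕜) := by
  have h_iterate : (Lp.compMeasurePreservingₗᵢ 𝕜 S hS)^[i] =
      Lp.compMeasurePreserving S^[i] (hS.iterate i) :=
    Lp.compMeasurePreserving_iterate (E := 𝕜) (p := 2) hS i
  rw [h_iterate, Lp.indicatorConstLp_compMeasurePreserving,
    L2.inner_indicatorConstLp_one_indicatorConstLp_one hA ((hS.iterate i).measurable hC)]

lemma exists_invariant_tendsto_cesaro_measureReal_inter [IsFiniteMeasure ρ]
    (hS : MeasurePreserving S ρ ρ) {C : Set Z} (hC : MeasurableSet C) :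
    ∃ u : Z → ℝ, Integrable u ρ ∧ u ∘ S =ᵐ[ρ] u ∧ ∀ A, MeasurableSet A →
      Tendsto (cesaro fun i => ρ.real (A ∩ S^[i] ⁻¹' C)) atTop (𝓝 (∫ x in A, u x ∂ρ)) := by
  let U := Lp.compMeasurePreservingₗᵢ (E := ℝ) (p := 2) ℝ S hS
  obtain ⟨u, h_fixed, h_lim⟩ := exists_fixed_tendsto_cesaro_iterate
    U.norm_toContinuousLinearMap_le (indicatorConstLp 2 hC (measure_ne_top ρ C) (1 : ℝ))
  refine ⟨u, (Lp.memLp u).integrable one_le_two, ?_, fun A hA => ?_⟩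
  · exact (Lp.coeFn_compMeasurePreserving u hS).symm.trans (Lp.ext_iff.1 h_fixed)
  · rw [← L2.inner_indicatorConstLp_one hA (measure_ne_top ρ A)]
    have h_inner := tendsto_map_cesaro
      (innerSL ℝ (indicatorConstLp 2 hA (measure_ne_top ρ A) (1 : ℝ))) h_lim
    refine h_inner.congr fun N => congrFun (congrArg cesaro (funext fun i => ?_)) N
    exact inner_indicator_iterate_compMeasurePreserving ℝ hS hA hC i

theorem tendsto_cesaro_measureReal_inter_of_ergodic [IsProbabilityMeasure ρ] (hS : Ergodic S ρ)
    {A C : Set Z} (hA : MeasurableSet A) (hC : MeasurableSet C) :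
    Tendsto (cesaro fun i => ρ.real (A ∩ S^[i] ⁻¹' C)) atTop (𝓝 (ρ.real A * ρ.real C)) := by
  obtain ⟨u, hu, h_inv, h_lim⟩ :=
    exists_invariant_tendsto_cesaro_measureReal_inter hS.toMeasurePreserving hC
  obtain ⟨c, hc⟩ := hS.quasiErgodic.ae_eq_const_of_ae_eq_comp_ae hu.aestronglyMeasurable h_inv
  have h_integral : ∀ B : Set Z, ∫ x in B, u x ∂ρ = ρ.real B * c := fun B => by
    rw [integral_congr_ae (ae_restrict_of_ae hc)]
    simp
  have h_univ := h_lim _ .univ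
  simp only [Set.univ_inter, (hS.iterate _).measureReal_preimage hC.nullMeasurableSet,
    h_integral, probReal_univ, one_mul] at h_univ
  rw [tendsto_nhds_unique (tendsto_cesaro_const _) h_univ, ← h_integral]
  exact h_lim A hA

lemma ae_eq_of_setIntegral_eq_of_generateFrom {E : Type*} [NormedAddCommGroup E]
    [NormedSpace ℝ E] [CompleteSpace E] {u v : Z → E} (hu : Integrable u ρ) (hv : Integrable v ρ)
    {𝒞 : Set (Set Z)} (hgen : ‹MeasurableSpace Z› = .generateFrom 𝒞) (hpi : IsPiSystem 𝒞)
    (h_univ : ∫ x, u x ∂ρ = ∫ x, v x ∂ρ)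
    (h : ∀ A ∈ 𝒞, ∫ x in A, u x ∂ρ = ∫ x in A, v x ∂ρ) : u =ᵐ[ρ] v := by
  refine hu.ae_eq_of_withDensityᵥ_eq hv
    (VectorMeasure.ext_of_generateFrom 𝒞 (fun A hA => ?_) hgen hpi ?_)
  · have hA_meas : MeasurableSet A := hgen ▸ MeasurableSpace.measurableSet_generateFrom hA
    rw [withDensityᵥ_apply hu hA_meas, withDensityᵥ_apply hv hA_meas, h A hA]
  · rwa [withDensityᵥ_apply hu .univ, withDensityᵥ_apply hv .univ, setIntegral_univ,
      setIntegral_univ]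

variable [IsProbabilityMeasure ρ] {𝒞 : Set (Set Z)}

lemma tendsto_cesaro_measureReal_inter_of_generateFrom (hS : MeasurePreserving S ρ ρ)
    (hgen : ‹MeasurableSpace Z› = .generateFrom 𝒞) (hpi : IsPiSystem 𝒞) {C : Set Z}
    (hC : MeasurableSet C)
    (h : ∀ A ∈ 𝒞,
      Tendsto (cesaro fun i => ρ.real (A ∩ S^[i] ⁻¹' C)) atTop (𝓝 (ρ.real A * ρ.real C)))
    {A : Set Z} (hA : MeasurableSet A) :
    Tendsto (cesaro fun i => ρ.real (A ∩ S^[i] ⁻¹' C)) atTop (𝓝 (ρ.real A * ρ.real C)) := by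
  obtain ⟨u, hu, -, h_lim⟩ := exists_invariant_tendsto_cesaro_measureReal_inter hS hC
  have hu_const : u =ᵐ[ρ] fun _ => ρ.real C := by
    refine ae_eq_of_setIntegral_eq_of_generateFrom hu (integrable_const _) hgen hpi ?_ ?_
    · have h_univ := h_lim _ .univ
      simp only [Set.univ_inter, (hS.iterate _).measureReal_preimage hC.nullMeasurableSet,
        setIntegral_univ] at h_univ
      simpa using tendsto_nhds_unique h_univ (tendsto_cesaro_const _)
    · intro B hB
      have hB_meas : MeasurableSet B := hgen ▸ MeasurableSpace.measurableSet_generateFrom hB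
      simpa using tendsto_nhds_unique (h_lim B hB_meas) (h B hB)
  have h_limit := h_lim A hA
  rwa [integral_congr_ae (ae_restrict_of_ae hu_const), setIntegral_const, smul_eq_mul] at h_limit

lemma measure_eq_zero_or_one_of_generateFrom (hgen : ‹MeasurableSpace Z› = .generateFrom 𝒞)
    (hpi : IsPiSystem 𝒞) {E : Set Z} (hE : MeasurableSet E)
    (h : ∀ C ∈ 𝒞, ρ (E ∩ C) = ρ E * ρ C) : ρ E = 0 ∨ ρ E = 1 := by
  have h_sets : IndepSets {E} 𝒞 ρ := (IndepSets_iff _ _ _).2 fun _ C hE' hC => by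
    rw [Set.mem_singleton_iff.1 hE', h C hC]
  have h_indep : Indep (.generateFrom {E}) ‹MeasurableSpace Z› ρ :=
    h_sets.indep (MeasurableSpace.generateFrom_le (by simpa using hE)) le_rfl
      (.singleton E) hpi rfl hgen
  refine measure_eq_zero_or_one_of_indepSet_self ?_
  exact h_indep.indepSet_of_measurableSet
    (MeasurableSpace.measurableSet_generateFrom (Set.mem_singleton E)) hE

theorem ergodic_of_tendsto_cesaro_measureReal_inter (hS : MeasurePreserving S ρ ρ)
    (hgen : ‹MeasurableSpace Z› = .generateFrom 𝒞) (hpi : IsPiSystem 𝒞)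
    (h : ∀ A ∈ 𝒞, ∀ C ∈ 𝒞,
      Tendsto (cesaro fun i => ρ.real (A ∩ S^[i] ⁻¹' C)) atTop (𝓝 (ρ.real A * ρ.real C))) :
    Ergodic S ρ := by
  refine ⟨hS, ⟨fun E hE h_inv => ?_⟩⟩
  have h_inter : ∀ C ∈ 𝒞, ρ (E ∩ C) = ρ E * ρ C := fun C hC => by
    have hC_meas : MeasurableSet C := hgen ▸ MeasurableSpace.measurableSet_generateFrom hC
    have h_lim := tendsto_cesaro_measureReal_inter_of_generateFrom hS hgen hpi hC_meas
      (fun A hA => h A hA C hC) hE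
    have h_const : ∀ i, ρ.real (E ∩ S^[i] ⁻¹' C) = ρ.real (E ∩ C) := fun i => by
      have h_preimage : S^[i] ⁻¹' E = E := by
        rw [Set.preimage_iterate_eq]
        exact Function.iterate_fixed h_inv i
      rw [← (hS.iterate i).measureReal_preimage (hE.inter hC_meas).nullMeasurableSet,
        Set.preimage_inter, h_preimage]
    simp only [h_const] at h_lim
    rw [← ENNReal.toReal_eq_toReal_iff' (by finiteness) (by finiteness), ENNReal.toReal_mul]
    exact tendsto_nhds_unique (tendsto_cesaro_const _) h_lim
  rw [eventuallyConst_set']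
  exact (measure_eq_zero_or_one_of_generateFrom hgen hpi hE h_inter).imp ae_eq_empty.2
    fun h_one => ae_eq_univ.2 ((prob_compl_eq_zero_iff hE).2 h_one)

end Ergodic

section AlmostMixing

variable {X : Type*} [MeasurableSpace X] {μ : Measure X} {T : X ≃ᵐ X}

lemma measureReal_iterate_image_inter (hT : MeasurePreserving T μ μ) {A B : Set X}
    (hA : MeasurableSet A) (hB : MeasurableSet B) (i : ℕ) :
    μ.real (T^[i] '' A ∩ B) = μ.real (A ∩ T^[i] ⁻¹' B) := by
  have h_image : T^[i] '' A = T.symm^[i] ⁻¹' A :=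
    congrFun (Set.image_eq_preimage_of_inverse
      (Function.LeftInverse.iterate T.symm_apply_apply i)
      (Function.RightInverse.iterate T.apply_symm_apply i)) A
  have h_meas : MeasurableSet (T^[i] '' A) := h_image ▸ T.symm.measurable.iterate i hA
  rw [← (hT.iterate i).measureReal_preimage (h_meas.inter hB).nullMeasurableSet, Set.preimage_inter,
    Set.preimage_image_eq _ (T.injective.iterate i)]

lemma isAlmostMixing_iff [IsProbabilityMeasure μ] (hT : MeasurePreserving T μ μ) :
    IsAlmostMixing μ T ↔ ∀ A B : Set X, MeasurableSet A → MeasurableSet B →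
      Tendsto (cesaro fun i => |μ.real (A ∩ T^[i] ⁻¹' B) - μ.real A * μ.real B|)
        atTop (𝓝 0) := by
  refine forall₄_congr fun A B hA hB => ?_
  simp only [one_div_mul_sum_Icc_eq_cesaro, measureReal_iterate_image_inter hT hA hB]
  refine tendsto_cesaro_succ_iff
    (c := fun i => |μ.real (A ∩ T^[i] ⁻¹' B) - μ.real A * μ.real B|) (M := 1) fun i => ?_
  rw [Real.norm_eq_abs, abs_abs]
  exact abs_sub_le_of_nonneg_of_le measureReal_nonneg measureReal_le_one (by positivity)
    (mul_le_one₀ measureReal_le_one measureReal_nonneg measureReal_le_one)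

theorem IsAlmostMixing.hasErgodicProducts [IsProbabilityMeasure μ] (hT : MeasurePreserving T μ μ)
    (h : IsAlmostMixing μ T) : HasErgodicProducts μ T := by
  rw [isAlmostMixing_iff hT] at h
  intro Y _ _ ν _ S hS
  refine ergodic_of_tendsto_cesaro_measureReal_inter (hS.toMeasurePreserving.prod hT)
    generateFrom_prod.symm isPiSystem_prod ?_
  rintro _ ⟨A, hA, B, hB, rfl⟩ _ ⟨C, hC, D, hD, rfl⟩
  simp only [Prod.map_iterate, Set.preimage_prod_map_prod, Set.prod_inter_prod,
    measureReal_prod_prod]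
  rw [mul_mul_mul_comm]
  refine tendsto_cesaro_mul (M := 1) (fun i => ?_)
    (tendsto_cesaro_measureReal_inter_of_ergodic hS hA hC) (h B D hB hD)
  rw [abs_of_nonneg measureReal_nonneg]
  exact measureReal_le_one

lemma ergodic_id_of_subsingleton {Y : Type*} [MeasurableSpace Y] [Subsingleton Y]
    (ν : Measure Y) : Ergodic id ν := by
  refine ⟨.id ν, ⟨fun s _ _ => eventuallyConst_set'.2 ?_⟩⟩
  exact s.eq_empty_or_nonempty.imp .of_eq fun hs => .of_eq (Subsingleton.eq_univ_of_nonempty hs)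

lemma HasErgodicProducts.ergodic [SFinite μ] (h : HasErgodicProducts μ T) : Ergodic T μ :=
  measurePreserving_snd.ergodic_of_ergodic_semiconj
    (h PUnit (Measure.dirac PUnit.unit) (.refl PUnit) (ergodic_id_of_subsingleton _))
    T.measurable fun _ => rfl

end AlmostMixing

section WeakOperatorConvergence

lemma tendsto_of_dense_of_lipschitzWith {α β ι : Type*} [PseudoMetricSpace α]
    [PseudoMetricSpace β] {l : Filter ι} {K : NNReal} {F : ι → α → β} {G : α → β}
    (hF : ∀ i, LipschitzWith K (F i)) (hG : Continuous G) {s : Set α} (hs : Dense s)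
    (h : ∀ x ∈ s, Tendsto (F · x) l (𝓝 (G x))) (x : α) : Tendsto (F · x) l (𝓝 (G x)) :=
  have h_equicontinuous := (LipschitzWith.uniformEquicontinuous F K hF).equicontinuous
  hs.induction h (h_equicontinuous.isClosed_setOfPred_tendsto hG) x

lemma tendsto_inner_apply_of_dense {𝕜 H ι : Type*} [RCLike 𝕜] [NormedAddCommGroup H]
    [InnerProductSpace 𝕜 H] {l : Filter ι} {B : ι → H →L[𝕜] H} {A : H →L[𝕜] H} {M : NNReal}
    (hB : ∀ i x, ‖B i x‖ ≤ M * ‖x‖) {s : Set H} (hs : Dense s)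
    (h : ∀ x ∈ s, ∀ y ∈ s, Tendsto (fun i => inner 𝕜 y (B i x)) l (𝓝 (inner 𝕜 y (A x))))
    (x y : H) : Tendsto (fun i => inner 𝕜 y (B i x)) l (𝓝 (inner 𝕜 y (A x))) := by
  have h_bound : ∀ i x y, ‖inner 𝕜 y (B i x)‖ ≤ ‖y‖ * (M * ‖x‖) := fun i x y =>
    (norm_inner_le_norm (𝕜 := 𝕜) y _).trans (by gcongr; exact hB i x)
  have h_dense_right : ∀ y ∈ s, ∀ x,
      Tendsto (fun i => inner 𝕜 y (B i x)) l (𝓝 (inner 𝕜 y (A x))) := fun y hy =>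
    tendsto_of_dense_of_lipschitzWith (K := ‖y‖₊ * M) (fun i => .of_dist_le_mul fun x x' => by
      rw [dist_eq_norm, dist_eq_norm, ← inner_sub_right, ← map_sub]
      exact (h_bound i _ y).trans_eq (mul_assoc _ _ _).symm) (by fun_prop) hs
      fun x hx => h x hx y hy
  exact tendsto_of_dense_of_lipschitzWith (K := M * ‖x‖₊) (fun i => .of_dist_le_mul fun y y' => by
      rw [dist_eq_norm, dist_eq_norm, ← inner_sub_left]
      exact (h_bound i x _).trans_eq (mul_comm _ _)) (by fun_prop) hs
      (fun y hy => h_dense_right y hy x) y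

end WeakOperatorConvergence

section ContinuousSpectrum

lemma ae_eq_zero_of_ergodic_prod {Z : Type*} [MeasurableSpace Z] {ρ : Measure Z}
    [IsProbabilityMeasure ρ] {S : Z → Z} (hS : Ergodic (Prod.map S S) (ρ.prod ρ)) {z : ℂ}
    (hz : ‖z‖ = 1) {f : Z → ℂ} (hf : Integrable f ρ) (h_mean : ∫ x, f x ∂ρ = 0)
    (h_eigen : f ∘ S =ᵐ[ρ] z • f) : f =ᵐ[ρ] 0 := by
  let F : Z × Z → ℂ := fun p => f p.1 * starRingEnd ℂ (f p.2)
  have hF_meas : AEStronglyMeasurable F (ρ.prod ρ) := hf.1.comp_fst.mul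
    (Complex.continuous_conj.comp_aestronglyMeasurable hf.1).comp_snd
  have hF_inv : F ∘ Prod.map S S =ᵐ[ρ.prod ρ] F := by
    filter_upwards [Measure.quasiMeasurePreserving_fst.ae_eq_comp h_eigen,
      Measure.quasiMeasurePreserving_snd.ae_eq_comp h_eigen] with p h_fst h_snd
    have hzz : z * starRingEnd ℂ z = 1 := by rw [Complex.mul_conj', hz]; norm_num
    simp only [Function.comp_apply, Pi.smul_apply, smul_eq_mul] at h_fst h_snd
    simp only [F, Function.comp_apply, Prod.map_fst, Prod.map_snd, h_fst, h_snd, map_mul]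
    linear_combination (f p.1 * starRingEnd ℂ (f p.2)) * hzz
  obtain ⟨c, hc⟩ := hS.quasiErgodic.ae_eq_const_of_ae_eq_comp_ae hF_meas hF_inv
  have hc_zero : c = 0 :=
    calc c = ∫ p, F p ∂ρ.prod ρ := by simp [integral_congr_ae hc]
      _ = (∫ x, f x ∂ρ) * ∫ y, starRingEnd ℂ (f y) ∂ρ :=
          integral_prod_mul f (fun y => starRingEnd ℂ (f y))
      _ = 0 := by rw [h_mean, zero_mul]
  have h_norm : (∫ x, ‖f x‖ ∂ρ) * ∫ y, ‖f y‖ ∂ρ = 0 :=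
    calc (∫ x, ‖f x‖ ∂ρ) * ∫ y, ‖f y‖ ∂ρ = ∫ p, ‖f p.1‖ * ‖f p.2‖ ∂ρ.prod ρ :=
          (integral_prod_mul _ _).symm
      _ = ∫ p, ‖F p‖ ∂ρ.prod ρ := by simp [F]
      _ = 0 := by
          rw [integral_congr_ae (hc.mono fun p hp => congrArg norm hp)]
          simp [hc_zero]
  have h_ae := (integral_eq_zero_iff_of_nonneg (fun x => norm_nonneg _) hf.norm).1
    (mul_self_eq_zero.1 h_norm)
  exact h_ae.mono fun x hx => norm_eq_zero.1 hx

variable {X : Type*} [MeasurableSpace X] {μ : Measure X} {T : X ≃ᵐ X}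
  {hT : MeasurePreserving T μ μ}

lemma norm_koopman_pow_apply (n : ℕ) (f : Lp ℂ 2 μ) : ‖(koopman T hT ^ n) f‖ = ‖f‖ := by
  induction n with
  | zero => rfl
  | succ n ih =>
    rw [pow_succ', mul_apply_eq_comp, ← ih]
    exact Lp.norm_compMeasurePreserving _ hT

variable [IsProbabilityMeasure μ]

lemma norm_const_one (μ : Measure X) [IsProbabilityMeasure μ] : ‖Lp.const 2 μ (1 : ℂ)‖ = 1 := by
  simp [Lp.norm_const]

lemma Theta_apply (f : Lp ℂ 2 μ) :
    Theta μ f = inner ℂ (Lp.const 2 μ 1) f • Lp.const 2 μ (1 : ℂ) :=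
  Submodule.starProjection_unit_singleton ℂ (norm_const_one μ) f

lemma mem_constants_orthogonal_iff (f : Lp ℂ 2 μ) :
    f ∈ (constants μ)ᗮ ↔ inner ℂ (Lp.const 2 μ 1) f = 0 :=
  Submodule.mem_orthogonal_singleton_iff_inner_right

lemma inner_indicator_Theta_indicator {A B : Set X} (hA : MeasurableSet A)
    (hB : MeasurableSet B) :
    inner ℂ (indicatorConstLp 2 hA (measure_ne_top μ A) (1 : ℂ))
      (Theta μ (indicatorConstLp 2 hB (measure_ne_top μ B) (1 : ℂ))) =
      ((μ.real A * μ.real B : ℝ) : ℂ) := by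
  rw [Theta_apply, inner_smul_right, ← indicatorConstLp_univ,
    L2.inner_indicatorConstLp_one_indicatorConstLp_one .univ hB,
    L2.inner_indicatorConstLp_one_indicatorConstLp_one hA .univ, Set.univ_inter, Set.inter_univ,
    mul_comm, Complex.ofReal_mul]
  rfl

lemma koopman_Theta (f : Lp ℂ 2 μ) : koopman T hT (Theta μ f) = Theta μ f := by
  rw [Theta_apply, map_smul]
  rfl

lemma Theta_koopman (f : Lp ℂ 2 μ) : Theta μ (koopman T hT f) = Theta μ f := by
  have h_inner : inner ℂ (Lp.const 2 μ 1) (koopman T hT f) = inner ℂ (Lp.const 2 μ 1) f :=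
    (Lp.compMeasurePreservingₗᵢ ℂ T hT).inner_map_map (Lp.const 2 μ 1) f
  rw [Theta_apply, Theta_apply, h_inner]

theorem hasContinuousSpectrum_of_ergodic_prod (h : Ergodic (Prod.map T T) (μ.prod μ)) :
    HasContinuousSpectrum T hT := by
  intro z f hf hz
  by_contra hf0
  refine hf0 (Lp.eq_zero_iff_ae_eq_zero.2 (ae_eq_zero_of_ergodic_prod h
    (norm_eq_one_of_map_eq_smul (U := Lp.compMeasurePreservingₗᵢ ℂ T hT) hf0 hz)
    ((Lp.memLp f).integrable one_le_two) ?_ ?_))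
  · rw [mem_constants_orthogonal_iff, ← indicatorConstLp_univ,
      L2.inner_indicatorConstLp_one, setIntegral_univ] at hf
    exact hf
  · calc f ∘ T =ᵐ[μ] koopman T hT f := (Lp.coeFn_compMeasurePreserving f hT).symm
      _ =ᵐ[μ] z • f := hz ▸ Lp.coeFn_smul z f

theorem IsWeaklyMixing.hasContinuousSpectrum (h : IsWeaklyMixing T hT) :
    HasContinuousSpectrum T hT := by
  obtain ⟨n, -, hn⟩ := h
  intro z f hf hz
  by_contra hf0
  have hz_norm := norm_eq_one_of_map_eq_smul (U := Lp.compMeasurePreservingₗᵢ ℂ T hT) hf0 hz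
  have h_pow : ∀ k : ℕ, (koopman T hT ^ k) f = z ^ k • f := fun k => by
    induction k with
    | zero => simp
    | succ k ih => rw [pow_succ', mul_apply_eq_comp, ih, map_smul, hz, smul_smul, pow_succ]
  have h_lim := (hn f f).norm
  have h_norm : ∀ i, ‖(inner ℂ f ((koopman T hT ^ n i) f) : ℂ)‖ = ‖f‖ ^ 2 := fun i => by
    rw [h_pow, inner_smul_right, norm_mul, norm_pow, hz_norm, one_pow, one_mul,
      inner_self_eq_norm_sq_to_K]
    simp
  simp only [h_norm, Theta_apply, (mem_constants_orthogonal_iff f).1 hf, zero_smul,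
    inner_zero_right, norm_zero] at h_lim
  exact hf0 (by simpa using tendsto_nhds_unique tendsto_const_nhds h_lim)

namespace HasContinuousSpectrum

lemma mem_constants (h : HasContinuousSpectrum T hT) {z : ℂ} {v : Lp ℂ 2 μ}
    (hv : koopman T hT v = z • v) : v ∈ constants μ := by
  have h_Theta : Theta μ v = z • Theta μ v := by rw [← map_smul, ← hv, Theta_koopman]
  have h_zero : v - Theta μ v = 0 :=
    h z _ (Submodule.sub_starProjection_mem_orthogonal v) <| by
      rw [map_sub, hv, koopman_Theta, smul_sub, ← h_Theta]
  rw [sub_eq_zero.1 h_zero]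
  exact Submodule.starProjection_apply_mem _ v

theorem tendsto_cesaro_norm_inner_sub (h : HasContinuousSpectrum T hT) (f g : Lp ℂ 2 μ) :
    Tendsto (cesaro fun i => ‖inner ℂ g ((koopman T hT)^[i] f) - inner ℂ g (Theta μ f)‖)
      atTop (𝓝 0) := by
  have h_decay := tendsto_cesaro_abs_of_sq (tendsto_cesaro_norm_inner_iterate_sq
    (U := Lp.compMeasurePreservingₗᵢ ℂ T hT) (f := f - Theta μ f) (fun z v hv =>
      Submodule.inner_right_of_mem_orthogonal (h.mem_constants hv)
        (Submodule.sub_starProjection_mem_orthogonal f)) g)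
  refine h_decay.congr fun N => congrFun (congrArg cesaro (funext fun i => ?_)) N
  have h_fixed : (koopman T hT)^[i] (Theta μ f) = Theta μ f :=
    Function.iterate_fixed (koopman_Theta f) i
  rw [abs_norm, ← inner_sub_right]
  nth_rw 2 [← h_fixed]
  rw [← iterate_map_sub]
  rfl

theorem isAlmostMixing (h : HasContinuousSpectrum T hT) : IsAlmostMixing μ T := by
  refine (isAlmostMixing_iff hT).2 fun A B hA hB => ?_
  refine (h.tendsto_cesaro_norm_inner_sub
    (indicatorConstLp 2 hB (measure_ne_top μ B) (1 : ℂ))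
    (indicatorConstLp 2 hA (measure_ne_top μ A) (1 : ℂ))).congr fun N =>
      congrFun (congrArg cesaro (funext fun i => ?_)) N
  have h_inner : inner ℂ (indicatorConstLp 2 hA (measure_ne_top μ A) (1 : ℂ))
      ((koopman T hT)^[i] (indicatorConstLp 2 hB (measure_ne_top μ B) (1 : ℂ))) =
      (μ.real (A ∩ T^[i] ⁻¹' B) : ℂ) :=
    inner_indicator_iterate_compMeasurePreserving ℂ hT hA hB i
  rw [h_inner, inner_indicator_Theta_indicator, ← Complex.ofReal_sub, Complex.norm_real,
    Real.norm_eq_abs]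

end HasContinuousSpectrum

theorem HasContinuousSpectrum.isWeaklyMixing [MeasureTheory.IsSeparable μ]
    (h : HasContinuousSpectrum T hT) : IsWeaklyMixing T hT := by
  have : Fact ((2 : ENNReal) ≠ ⊤) := ⟨by simp⟩
  obtain ⟨s, hs_countable, hs_dense⟩ := TopologicalSpace.exists_countable_dense (Lp ℂ 2 μ)
  have := hs_countable.to_subtype
  obtain ⟨n, hn, h_lim⟩ := exists_strictMono_tendsto_zero_of_tendsto_cesaro
    (fun (p : s × s) i => norm_nonneg _)
    (fun p => h.tendsto_cesaro_norm_inner_sub (p.1 : Lp ℂ 2 μ) (p.2 : Lp ℂ 2 μ))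
  refine ⟨n, hn.tendsto_atTop, tendsto_inner_apply_of_dense (M := 1) (fun i f => ?_) hs_dense
    fun f hf g hg => ?_⟩
  · rw [norm_koopman_pow_apply, NNReal.coe_one, one_mul]
  · rw [tendsto_iff_norm_sub_tendsto_zero]
    simpa only [FunLike.coe_pow_eq_iterate] using h_lim (⟨f, hf⟩, ⟨g, hg⟩)

end ContinuousSpectrum

theorem theorem4p1 {X : Type*} [MeasurableSpace X] [StandardBorelSpace X]
    (μ : Measure X) [IsProbabilityMeasure μ] (T : X ≃ᵐ X) (hT : MeasurePreserving T μ μ) :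
    List.TFAE [
      IsWeaklyMixing T hT,
      HasContinuousSpectrum T hT,
      Ergodic (Prod.map T T) (μ.prod μ),
      IsAlmostMixing μ T,
      HasErgodicProducts μ T] := by
  tfae_have 1 → 2 := IsWeaklyMixing.hasContinuousSpectrum
  tfae_have 2 → 1 := HasContinuousSpectrum.isWeaklyMixing
  tfae_have 2 → 4 := HasContinuousSpectrum.isAlmostMixing
  tfae_have 4 → 5 := IsAlmostMixing.hasErgodicProducts hT
  tfae_have 5 → 3 := fun h => h X μ T h.ergodic
  tfae_have 3 → 2 := hasContinuousSpectrum_of_ergodic_prod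
  tfae_finish
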